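/- For $c\in\mathbb{R}$, $1\le p\le\infty$ and $f:\mathbb{R}^+\to\mathbb{C}$ put $\|f\|_{X^p_c}:=\left(\int_0^\infty |x^c f(x)|^p\,\frac{dx}{x}\right)^{1/p}$ if $p<\infty$ and $\|f\|_{X^\infty_c}:=\sup_{x>0}|x^c f(x)|$ (values in $[0,\infty]$). For $\sigma>0$ let $B^\infty_{c,\sigma}$ be the space of all continuous functions $f:\mathbb{R}^+\to\mathbb{C}$ with $\|f\|_{X^\infty_c}<\infty$ that are Mellin band-limited to $[-\sigma,\sigma]$, that is, whose Mellin transform $t\mapsto [f]^\wedge_{M_c}(c+it)=\int_0^\infty f(u)u^{c+it-1}\,du$, understood as a distribution in $t$, vanishes on $\{|t|>\sigma\}$: $$\int_0^\infty f(u)\,u^{c-1}\left(\int_{\mathbb{R}}\varphi(t)\,u^{it}\,dt\right)du=0\quad\text{for all }\varphi\in C_c^\infty(\mathbb{R},\mathbb{C})\text{ with }\operatorname{supp}\varphi\subset\{|t|>\sigma\}.$$ Let $\Theta_c f(x):=\lim_{h\to1}\dfrac{h^c f(hx)-f(x)}{h-1}$ ($x>0$) denote the Mellin derivative. Theorem.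 Let $c\in\mathbb{R}$, $T>0$ and $f\in B^\infty_{c,\pi T}$. Then for every $x>0$ the Mellin derivative $\Theta_c f(x)$ exists, the following series converges absolutely, and $$\Theta_c f(x)=\frac{4T}{\pi}\sum_{k\in\mathbb{Z}}\frac{(-1)^{k+1}}{(2k-1)^2}\,e^{(k-1/2)c/T}\,f\!\left(x\,e^{(k-1/2)/T}\right).$$ Consequently, for every $p\in[1,\infty]$, $\|\Theta_c f\|_{X^p_c}\le \pi T\,\|f\|_{X^p_c}$. -/

import Mathlib

open MeasureTheory Set Filter Topology
open scoped ENNReal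

/-! Functions on `ℝ⁺ = (0, ∞)` are represented by functions `ℝ → ℂ`; every notion below
only uses their values on `(0, ∞)`. -/

noncomputable section

/-- The invariant measure `dx / x` on `(0, ∞)`. -/
def mellinMeasure : Measure ℝ :=
  (volume.restrict (Ioi (0 : ℝ))).withDensity fun x => ENNReal.ofReal x⁻¹

/-- The norm of the space `X^p_c`, with value `∞` outside of the space:
the `L^p (dx / x)` norm of `x ^ c * f x` if `p < ∞`,
and the supremum of `|x ^ c * f x|` over `x > 0` if `p = ∞`. -/
def mellinNorm (c : ℝ) (p : ℝ≥0∞) (f : ℝ → ℂ) : ℝ≥0∞ :=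
  if p = ∞ then ⨆ x ∈ Ioi (0 : ℝ), ‖((x ^ c : ℝ) : ℂ) * f x‖ₑ
  else eLpNorm (fun x : ℝ => ((x ^ c : ℝ) : ℂ) * f x) p mellinMeasure

/-- The Mellin transform `t ↦ [f]^∧ (c + i t)` of `f`, taken in the sense of distributions in `t`,
vanishes for `|t| > σ`. Its pairing with a test function `φ` is
`∫ u in (0, ∞), f u * u ^ (c - 1) * (∫ t, φ t * u ^ (i t))`, which for `f ∈ X^1_c` equals
`∫ t, [f]^∧ (c + i t) * φ t` by Fubini's theorem. -/
def IsMellinBandLimited (c σ : ℝ) (f : ℝ → ℂ) : Prop :=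
  ∀ φ : ℝ → ℂ, ContDiff ℝ (⊤ : ℕ∞) φ → HasCompactSupport φ → (∀ t ∈ tsupport φ, σ < |t|) →
    (∫ u in Ioi (0 : ℝ),
      f u * ((u ^ (c - 1) : ℝ) : ℂ) * (∫ t : ℝ, φ t * (u : ℂ) ^ ((t : ℂ) * Complex.I))) = 0

/-- The Mellin-Bernstein space `B^p_{c,σ}`: continuous functions of `X^p_c` that are
Mellin band-limited to `[-σ, σ]`. -/
def MellinBernstein (c : ℝ) (p : ℝ≥0∞) (σ : ℝ) : Set (ℝ → ℂ) :=
  {f | ContinuousOn f (Ioi 0) ∧ mellinNorm c p f < ∞ ∧ IsMellinBandLimited c σ f}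

/-- The difference quotient `(h ^ c * f (h * x) - f x) / (h - 1)`. -/
def mellinQuotient (c : ℝ) (f : ℝ → ℂ) (x h : ℝ) : ℂ :=
  (((h ^ c : ℝ) : ℂ) * f (h * x) - f x) / ((h : ℂ) - 1)

/-- The Mellin derivative of `f` at `x` exists and equals `a`. -/
def HasMellinDerivAt (c : ℝ) (f : ℝ → ℂ) (a : ℂ) (x : ℝ) : Prop :=
  Tendsto (mellinQuotient c f x) (𝓝[≠] 1) (𝓝 a)

/-- The Mellin derivative `Θ_c f`. -/
def mellinDeriv (c : ℝ) (f : ℝ → ℂ) (x : ℝ) : ℂ :=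
  limUnder (𝓝[≠] (1 : ℝ)) (mellinQuotient c f x)

/-- The `k`-th term of the Boas-type series at `x`, without the factor `4 T / π`. -/
def mellinBoasTerm (c T : ℝ) (f : ℝ → ℂ) (x : ℝ) (k : ℤ) : ℂ :=
  (-1) ^ (k + 1) / (2 * (k : ℂ) - 1) ^ 2
    * ((Real.exp (((k : ℝ) - 1 / 2) * c / T) : ℝ) : ℂ)
    * f (x * Real.exp (((k : ℝ) - 1 / 2) / T))

end

/-! In the variable `s` with `x = exp (2 π s)`, the function `x ^ c * f x` becomes a bounded
continuous function `g` on `ℝ` with spectrum in `[-Ω, Ω]`, where `Ω = π T`, and `Θ_c` becomes a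
multiple of `d / ds`. On `[-W, W]` the symbol `2 π i t` of `d / ds` agrees with a triangle wave of
period `4 W`, whose Fourier series has the absolutely summable coefficients
`(-1) ^ (k + 1) / (2 k - 1) ^ 2` up to a factor. Hence `g'` is an absolutely convergent series of
translates of `g`, which is Boas's formula. Since the spectrum of `g` is only a distribution, the
symbol is first expanded on a Schwartz kernel that reproduces `g` and has spectrum in `[-W, W]` for
some `W > Ω`, and then `W` decreases to `Ω`. The norm inequality follows because the norms of
`X^p_c` are invariant under Mellin translation and the absolute values of the coefficients of the
translates add up to `π T`. -/

open scoped SchwartzMap FourierTransform BoundedContinuousFunction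

section BoasCoeff

/-- The coefficients `(-1) ^ (k + 1) / (2 k - 1) ^ 2` of Boas's series for the derivative of a
band-limited function. Up to a factor they are the Fourier coefficients of a triangle wave. -/
noncomputable def boasCoeff (k : ℤ) : ℂ := (-1) ^ (k + 1) / (2 * (k : ℂ) - 1) ^ 2

theorem hasSum_one_div_sq_mul_fourierChar {x : ℝ} (hx : x ∈ Icc (0 : ℝ) 1) :
    HasSum (fun n : ℤ => 1 / (n : ℂ) ^ 2 * 𝐞 (n * x))
      (2 * (Real.pi : ℂ) ^ 2 * ((x : ℂ) ^ 2 - x + 6⁻¹)) := by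
  convert! hasSum_one_div_pow_mul_fourier_mul_bernoulliFun (k := 2) le_rfl hx using 1
  · ext n
    rw [fourier_coe_apply, Real.fourierChar_apply]
    push_cast
    ring_nf
  · rw [bernoulliFun_two]
    push_cast [mul_pow, Complex.I_sq, Nat.factorial]
    ring

theorem fourierChar_int_mul (n : ℤ) (x : ℝ) : (𝐞 (n * x) : ℂ) = (𝐞 x : ℂ) ^ n := by
  rw [← zsmul_eq_mul, AddChar.map_zsmul_eq_zpow, Circle.coe_zpow]

theorem fourierChar_one_div_four : (𝐞 (1 / 4) : ℂ) = Complex.I := by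
  rw [Real.fourierChar_apply, show ((2 * Real.pi * (1 / 4) : ℝ) : ℂ) = Real.pi / 2 by
    push_cast; ring, Complex.exp_pi_div_two_mul_I]

theorem fourierChar_three_div_four : (𝐞 (3 / 4) : ℂ) = -Complex.I := by
  rw [show (3 / 4 : ℝ) = (3 : ℤ) * (1 / 4) by norm_num, fourierChar_int_mul,
    fourierChar_one_div_four]
  exact_mod_cast Complex.I_pow_three

theorem I_zpow_two_mul_sub_one (k : ℤ) :
    Complex.I ^ (2 * k - 1) = Complex.I * (-1) ^ (k + 1) := by
  rw [zpow_sub_one₀ Complex.I_ne_zero, zpow_mul, zpow_add_one₀ (by norm_num), zpow_ofNat,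
    Complex.I_sq, Complex.inv_I]
  ring

theorem hasSum_boasCoeff_mul_fourierChar {y : ℝ} (hy : |y| ≤ 1 / 4) :
    HasSum (fun k : ℤ => boasCoeff k * 𝐞 ((2 * k - 1) * y)) (Complex.I * Real.pi ^ 2 * y) := by
  obtain ⟨hy₁, hy₂⟩ := abs_le.1 hy
  -- In the difference of the series at `y + 1 / 4` and `y + 3 / 4` the even terms cancel.
  have hdiff := (hasSum_one_div_sq_mul_fourierChar (x := y + 1 / 4)
    ⟨by linarith, by linarith⟩).sub (hasSum_one_div_sq_mul_fourierChar (x := y + 3 / 4)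
    ⟨by linarith, by linarith⟩)
  have hterm (n : ℤ) : 1 / (n : ℂ) ^ 2 * 𝐞 (n * (y + 1 / 4)) - 1 / (n : ℂ) ^ 2 *
      𝐞 (n * (y + 3 / 4)) = 1 / (n : ℂ) ^ 2 * 𝐞 (n * y) * (Complex.I ^ n - (-Complex.I) ^ n) := by
    simp only [mul_add, AddChar.map_add_eq_mul, Circle.coe_mul, fourierChar_int_mul n (1 / 4),
      fourierChar_int_mul n (3 / 4), fourierChar_one_div_four, fourierChar_three_div_four]
    ring
  simp_rw [hterm] at hdiff
  have hinj : Function.Injective fun k : ℤ => 2 * k - 1 := fun a b h => by simpa using h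
  rw [← hinj.hasSum_iff] at hdiff
  · convert! hdiff.mul_left (-Complex.I / 2) using 1
    · ext k
      have hodd : Odd (2 * k - 1) := ⟨k - 1, by ring⟩
      simp only [Function.comp_apply, hodd.neg_zpow, I_zpow_two_mul_sub_one, boasCoeff]
      push_cast
      linear_combination (-1) ^ (k + 1) / (2 * (k : ℂ) - 1) ^ 2 * 𝐞 ((2 * k - 1) * y) *
        Complex.I_sq
    · push_cast
      ring
  · intro n hn
    have heven : Even n := by
      by_contra hodd
      obtain ⟨k, rfl⟩ := Int.not_even_iff_odd.1 hodd
      exact hn ⟨k + 1, by ring⟩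
    simp [heven.neg_zpow]

theorem hasSum_norm_boasCoeff : HasSum (fun k => ‖boasCoeff k‖) (Real.pi ^ 2 / 4) := by
  have h := (hasSum_boasCoeff_mul_fourierChar (y := 1 / 4) (by norm_num)).mul_left (-Complex.I)
  rw [← Complex.hasSum_ofReal]
  convert! h using 1
  · ext k
    have hreal : 2 * (k : ℂ) - 1 = ((2 * k - 1 : ℝ) : ℂ) := by push_cast; rfl
    have hchar : (𝐞 ((2 * k - 1) * (1 / 4)) : ℂ) = Complex.I * (-1) ^ (k + 1) := by
      rw [← I_zpow_two_mul_sub_one, ← fourierChar_one_div_four, ← fourierChar_int_mul]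
      push_cast
      rfl
    have hsign : ((-1 : ℂ) ^ (k + 1)) * (-1) ^ (k + 1) = 1 := by
      rw [← mul_zpow, neg_one_mul, neg_neg, one_zpow]
    rw [hchar, boasCoeff, norm_div, norm_zpow, norm_neg, norm_one, one_zpow, norm_pow, hreal,
      Complex.norm_real, Real.norm_eq_abs, sq_abs]
    push_cast
    linear_combination (1 / (2 * (k : ℂ) - 1) ^ 2) * ((-1) ^ (k + 1) * (-1) ^ (k + 1) *
      Complex.I_sq - hsign)
  · push_cast
    linear_combination (Real.pi ^ 2 / 4 : ℂ) * Complex.I_sq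

theorem summable_norm_boasCoeff : Summable fun k => ‖boasCoeff k‖ :=
  hasSum_norm_boasCoeff.summable

end BoasCoeff

section BandLimited

variable {E : Type*} [NormedAddCommGroup E] [NormedSpace ℂ E] {Ω : ℝ}

/-- The Fourier transform of `g` vanishes off `[-Ω, Ω]` in the sense of distributions. This is
tested on the Schwartz functions `K` whose Fourier transform is supported in an annulus
`r ≤ |t| ≤ R` with `Ω < r`. -/
def IsBandLimited (Ω : ℝ) (g : ℝ → E) : Prop :=
  ∀ (K : 𝓢(ℝ, ℂ)) ⦃r R : ℝ⦄, Ω < r → (∀ t, |t| ∉ Icc r R → 𝓕 K t = 0) → ∫ y, K y • g y = 0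

theorem integrable_smul_boundedContinuousFunction {K : ℝ → ℂ} (hK : Integrable K) (g : ℝ →ᵇ E) :
    Integrable fun y => K y • g y :=
  hK.smul_bdd ‖g‖ g.continuous.aestronglyMeasurable (ae_of_all _ g.norm_coe_le_norm)

theorem fourier_comp_const_sub (f : ℝ → E) (s t : ℝ) :
    𝓕 (fun y => f (s - y)) t = 𝐞 (-(s * t)) • 𝓕 f (-t) := by
  rw [Real.fourier_real_eq, Real.fourier_real_eq,
    ← integral_sub_left_eq_self (fun y => 𝐞 (-(y * t)) • f (s - y)) volume s]
  simp only [Circle.smul_def]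
  rw [← integral_smul]
  congr 1 with y
  rw [sub_sub_cancel, smul_smul, ← Circle.coe_mul, ← AddChar.map_add_eq_mul]
  ring_nf

theorem fourier_inv_smul_comp_inv_mul (f : ℝ → E) {l : ℝ} (hl : 0 < l) (t : ℝ) :
    𝓕 (fun y => l⁻¹ • f (l⁻¹ * y)) t = 𝓕 f (l * t) := by
  have h := Measure.integral_comp_mul_left (fun y => 𝐞 (-(y * (l * t))) • f y) l⁻¹
  rw [inv_inv, abs_of_pos hl] at h
  rw [Real.fourier_real_eq, Real.fourier_real_eq, ← inv_smul_eq_iff₀ hl.ne'] at *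
  rw [← h, ← integral_smul]
  congr 1 with y
  rw [smul_comm, show l⁻¹ * y * (l * t) = y * t by field_simp]

theorem IsBandLimited.comp_const_sub {g : ℝ → E} (hg : IsBandLimited Ω g) (s : ℝ) :
    IsBandLimited Ω fun y => g (s - y) := by
  intro K r R hr hK
  let L : 𝓢(ℝ, ℂ) := (SchwartzMap.compCLMOfContinuousLinearEquiv ℂ (.neg ℝ) K).compSubConstCLM ℂ s
  have hL : ⇑L = fun y => K (s - y) := by
    ext y
    simp [L]
  have hzero : ∫ y, L y • g y = 0 := by
    refine hg L (R := R) hr fun t ht => ?_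
    rw [SchwartzMap.fourier_coe, hL, fourier_comp_const_sub, ← SchwartzMap.fourier_coe,
      hK (-t) (by rwa [abs_neg]), smul_zero]
  rw [← hzero, ← integral_sub_left_eq_self _ volume s]
  simp only [hL, sub_sub_cancel]

theorem IsBandLimited.integral_smul_comp_mul {g : ℝ →ᵇ E} (hg : IsBandLimited Ω g) {K : 𝓢(ℝ, ℂ)}
    {r R l : ℝ} (hr : Ω < r) (hone : ∀ t, |t| ≤ r → 𝓕 K t = 1) (hzero : ∀ t, R < |t| → 𝓕 K t = 0)
    (hl : 0 < l) (hl₁ : l ≤ 1) :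
    ∫ y, K y • g (l * y) = ∫ y, K y • g y := by
  let L : 𝓢(ℝ, ℂ) := l⁻¹ • SchwartzMap.compCLMOfContinuousLinearEquiv ℂ
    (ContinuousLinearEquiv.smulLeft (Units.mk0 l⁻¹ (inv_ne_zero hl.ne'))) K
  have hL : ⇑L = fun y => l⁻¹ • K (l⁻¹ * y) := by
    ext y
    simp [L, Units.smul_def]
  have hLg : ∫ y, L y • g y = ∫ y, K y • g (l * y) := by
    have h := Measure.integral_comp_mul_left (fun y => K y • g (l * y)) l⁻¹
    rw [inv_inv, abs_of_pos hl, ← inv_smul_eq_iff₀ hl.ne', ← integral_smul] at h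
    rw [← h, hL]
    congr 1 with y
    rw [mul_inv_cancel_left₀ hl.ne', smul_assoc]
  have hKL : ∫ y, (K - L) y • g y = 0 := by
    refine hg (K - L) (R := R / l) hr fun t ht => ?_
    have hFL : 𝓕 L t = 𝓕 K (l * t) := by
      rw [SchwartzMap.fourier_coe, hL, fourier_inv_smul_comp_inv_mul _ hl, SchwartzMap.fourier_coe]
    have habs : |l * t| = l * |t| := by rw [abs_mul, abs_of_pos hl]
    have hle : l * |t| ≤ |t| := mul_le_of_le_one_left (abs_nonneg t) hl₁
    rw [sub_eq_add_neg K, FourierTransform.fourier_add, FourierTransform.fourier_neg,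
      ← sub_eq_add_neg, sub_apply, hFL]
    rcases lt_or_ge |t| r with htr | htr
    · rw [hone t htr.le, hone (l * t) (by linarith), sub_self]
    · have hRt : R < l * |t| := (div_lt_iff₀' hl).1 (not_le.1 fun h => ht ⟨htr, h⟩)
      rw [hzero t (by linarith), hzero (l * t) (by linarith), sub_self]
  simp only [sub_apply, sub_smul] at hKL
  rw [integral_sub (integrable_smul_boundedContinuousFunction K.integrable g)
    (integrable_smul_boundedContinuousFunction L.integrable g), hLg] at hKL
  exact (sub_eq_zero.1 hKL).symm

/- By `IsBandLimited.integral_smul_comp_mul` the integral of `K y • g (s - l * y)` does not depend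
on `l ∈ (0, 1]`, and for `l → 0` it tends to `(∫ K) • g s = g s`. -/
theorem IsBandLimited.integral_sub_smul [CompleteSpace E] {g : ℝ →ᵇ E} (hg : IsBandLimited Ω g)
    {K : 𝓢(ℝ, ℂ)} {r R : ℝ} (hr : Ω < r) (hr₀ : 0 ≤ r) (hone : ∀ t, |t| ≤ r → 𝓕 K t = 1)
    (hzero : ∀ t, R < |t| → 𝓕 K t = 0) (s : ℝ) :
    ∫ y, K (s - y) • g y = g s := by
  let h : ℝ →ᵇ E := g.compContinuous ⟨fun y => s - y, by fun_prop⟩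
  have hh : IsBandLimited Ω h := hg.comp_const_sub s
  have hcont : Continuous fun l : ℝ => ∫ y, K y • h (l * y) := by
    refine continuous_of_dominated (bound := fun y => ‖K y‖ * ‖h‖)
      (fun l => (K.continuous.smul (h.continuous.comp (by fun_prop))).aestronglyMeasurable)
      (fun l => ae_of_all _ fun y => ?_) (K.integrable.norm.mul_const _)
      (ae_of_all _ fun y => continuous_const.smul (h.continuous.comp (by fun_prop)))
    rw [norm_smul]
    gcongr
    exact h.norm_coe_le_norm _
  have hlim : Tendsto (fun l : ℝ => ∫ y, K y • h (l * y)) (𝓝[>] 0) (𝓝 (∫ y, K y • h y)) := by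
    refine tendsto_const_nhds.congr' ?_
    filter_upwards [Ioc_mem_nhdsGT one_pos] with l hl
    exact (hh.integral_smul_comp_mul hr hone hzero hl.1 hl.2).symm
  have hK : ∫ y, K y = 1 := by
    rw [← hone 0 (by simpa using hr₀), SchwartzMap.fourier_coe, Real.fourier_real_eq]
    simp
  calc ∫ y, K (s - y) • g y = ∫ y, K y • h y := by
        rw [← integral_sub_left_eq_self _ volume s]
        simp [h]
    _ = ∫ y, K y • h (0 * y) :=
        tendsto_nhds_unique hlim ((hcont.tendsto 0).mono_left nhdsWithin_le_nhds)
    _ = g s := by simp [h, integral_smul_const, hK]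

theorem exists_schwartzMap_fourier_eq_one {r R : ℝ} (hr : 0 < r) (hR : r < R) :
    ∃ K : 𝓢(ℝ, ℂ), (∀ t, |t| ≤ r → 𝓕 K t = 1) ∧ ∀ t, R < |t| → 𝓕 K t = 0 := by
  let χ : ContDiffBump (0 : ℝ) := ⟨r, R, hr, hR⟩
  have hsupp : HasCompactSupport fun t => (χ t : ℂ) :=
    χ.hasCompactSupport.comp_left (g := Complex.ofReal) Complex.ofReal_zero
  have hsmooth : ContDiff ℝ (⊤ : ℕ∞) fun t => (χ t : ℂ) :=
    Complex.ofRealCLM.contDiff.comp χ.contDiff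
  refine ⟨𝓕⁻ (hsupp.toSchwartzMap hsmooth), fun t ht => ?_, fun t ht => ?_⟩ <;>
    rw [FourierTransform.fourier_fourierInv_eq] <;> change (χ t : ℂ) = _
  · rw [χ.one_of_mem_closedBall (by simpa using ht), Complex.ofReal_one]
  · rw [χ.zero_of_le_dist (by simpa using ht.le), Complex.ofReal_zero]

theorem schwartzMap_eq_integral_fourier [CompleteSpace E] (K : 𝓢(ℝ, E)) (z : ℝ) :
    K z = ∫ t, 𝐞 (t * z) • 𝓕 K t := by
  conv_lhs => rw [← FourierTransform.fourierInv_fourier_eq (F := 𝓢(ℝ, E)) K,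
    SchwartzMap.fourierInv_coe, Real.fourierInv_eq]
  simp [mul_comm]

theorem fourier_derivCLM (K : 𝓢(ℝ, E)) (t : ℝ) :
    𝓕 (SchwartzMap.derivCLM ℂ E K) t = (2 * Real.pi * Complex.I * t) • 𝓕 K t :=
  congrFun (Real.fourier_deriv K.integrable K.differentiable
    (SchwartzMap.derivCLM ℂ E K).integrable) t

theorem hasSum_boasCoeff_mul_fourierChar_translate {W t : ℝ} (hW : 0 < W) (ht : |t| ≤ W) (z : ℝ) :
    HasSum (fun k : ℤ => boasCoeff k * 𝐞 (t * (z + ((k : ℝ) - 1 / 2) / (2 * W))))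
      ((Real.pi / (8 * W)) * (2 * Real.pi * Complex.I * t) * 𝐞 (t * z)) := by
  have hy : |t / (4 * W)| ≤ 1 / 4 := by
    rw [abs_div, abs_of_pos (by positivity : 0 < 4 * W), div_le_div_iff₀ (by positivity)
      (by norm_num)]
    linarith
  have hW' : (W : ℂ) ≠ 0 := by exact_mod_cast hW.ne'
  convert! (hasSum_boasCoeff_mul_fourierChar hy).mul_right (𝐞 (t * z) : ℂ) using 1
  · ext k
    rw [mul_assoc, ← Circle.coe_mul, ← AddChar.map_add_eq_mul]
    congr 3
    field_simp
    ring
  · push_cast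
    field_simp
    ring

theorem hasSum_boasCoeff_smul_schwartzMap [CompleteSpace E] {K : 𝓢(ℝ, E)} {W : ℝ} (hW : 0 < W)
    (hK : ∀ t, W < |t| → 𝓕 K t = 0) (z : ℝ) :
    HasSum (fun k : ℤ => boasCoeff k • K (z + ((k : ℝ) - 1 / 2) / (2 * W)))
      ((Real.pi / (8 * W) : ℂ) • deriv K z) := by
  have hint (x : ℝ) : Integrable fun t => 𝐞 (t * x) • 𝓕 K t := by
    simpa [mul_comm] using (Real.fourierIntegral_convergent_iff (-x)).2 (𝓕 K).integrable
  have hsum := hasSum_integral_of_summable_integral_norm (μ := volume)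
    (F := fun (k : ℤ) t => boasCoeff k • 𝐞 (t * (z + ((k : ℝ) - 1 / 2) / (2 * W))) • 𝓕 K t)
    (fun k => (hint _).smul _) (by
      simp_rw [norm_smul, Circle.norm_smul, integral_const_mul]
      exact summable_norm_boasCoeff.mul_right _)
  have hseries (t : ℝ) :
      ∑' k : ℤ, boasCoeff k • 𝐞 (t * (z + ((k : ℝ) - 1 / 2) / (2 * W))) • 𝓕 K t =
        (Real.pi / (8 * W) : ℂ) • 𝐞 (t * z) • 𝓕 (SchwartzMap.derivCLM ℂ E K) t := by
    rcases le_or_gt |t| W with ht | ht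
    · have h := (hasSum_boasCoeff_mul_fourierChar_translate hW ht z).smul_const (𝓕 K t)
      simp only [mul_smul, ← Circle.smul_def] at h
      rw [h.tsum_eq, fourier_derivCLM, smul_comm (𝐞 (t * z))]
      simp only [mul_smul]
    · simp [hK t ht, fourier_derivCLM]
  simp_rw [hseries, integral_smul, ← schwartzMap_eq_integral_fourier] at hsum
  exact hsum

theorem exists_integrable_norm_schwartzMap_sub_le {F : Type*} [NormedAddCommGroup F]
    [NormedSpace ℝ F] (K : 𝓢(ℝ, F)) (s : ℝ) :
    ∃ b : ℝ → ℝ, Integrable b ∧ ∀ x ∈ Metric.ball s 1, ∀ y, ‖K (x - y)‖ ≤ b y := by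
  obtain ⟨C, hC⟩ : ∃ C : ℝ, ∀ x, (1 + ‖x‖) ^ 2 * ‖K x‖ ≤ C :=
    ⟨_, fun x => by simpa using
      SchwartzMap.one_add_le_sup_seminorm_apply (𝕜 := ℝ) (m := (2, 0)) le_rfl le_rfl K x⟩
  refine ⟨fun y => 4 * C * (1 + ‖s - y‖) ^ (-2 : ℝ),
    ((integrable_one_add_norm (by simp)).comp_sub_left s).const_mul _, fun x hx y => ?_⟩
  have hpeetre : 1 + ‖s - y‖ ≤ 2 * (1 + ‖x - y‖) := by
    have hsx : ‖s - x‖ < 1 := by rwa [norm_sub_rev, ← mem_ball_iff_norm]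
    have htri : ‖s - y‖ ≤ ‖s - x‖ + ‖x - y‖ := norm_sub_le_norm_sub_add_norm_sub s x y
    linarith [norm_nonneg (x - y)]
  beta_reduce
  rw [Real.rpow_neg (by positivity), Real.rpow_two, ← div_eq_mul_inv, le_div_iff₀ (by positivity)]
  calc ‖K (x - y)‖ * (1 + ‖s - y‖) ^ 2 ≤ ‖K (x - y)‖ * (2 * (1 + ‖x - y‖)) ^ 2 := by gcongr
    _ = 4 * ((1 + ‖x - y‖) ^ 2 * ‖K (x - y)‖) := by ring
    _ ≤ 4 * C := by gcongr; exact hC _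

theorem hasDerivAt_integral_schwartzMap_sub_smul (K : 𝓢(ℝ, ℂ)) (g : ℝ →ᵇ E) (s : ℝ) :
    HasDerivAt (fun x => ∫ y, K (x - y) • g y) (∫ y, deriv K (s - y) • g y) s := by
  let K' : 𝓢(ℝ, ℂ) := SchwartzMap.derivCLM ℂ ℂ K
  have hmeas (L : 𝓢(ℝ, ℂ)) (x : ℝ) :
      AEStronglyMeasurable fun y => L (x - y) • g y :=
    ((L.continuous.comp (by fun_prop)).smul g.continuous).aestronglyMeasurable
  obtain ⟨b, hb, hK'b⟩ := exists_integrable_norm_schwartzMap_sub_le K' s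
  refine (hasDerivAt_integral_of_dominated_loc_of_deriv_le
    (F' := fun x y => K' (x - y) • g y) (Metric.ball_mem_nhds s one_pos)
    (Eventually.of_forall fun x => hmeas K x)
    (integrable_smul_boundedContinuousFunction (K.integrable.comp_sub_left s) g) (hmeas K' s)
    (ae_of_all _ fun y x hx => ?_) (hb.mul_const ‖g‖) (ae_of_all _ fun y x _ => ?_)).2
  · rw [norm_smul]
    gcongr
    exacts [(norm_nonneg _).trans (hK'b x hx y), hK'b x hx y, g.norm_coe_le_norm y]
  · exact (HasDerivAt.comp_sub_const x y K.differentiableAt.hasDerivAt).smul_const (g y)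

theorem hasSum_smul_integral_sub_smul {ι : Type*} [Countable ι] {c : ι → ℂ}
    (hc : Summable fun i => ‖c i‖) {K Φ : ℝ → ℂ} (hK : Integrable K) {τ : ι → ℝ}
    (hΦ : ∀ y, HasSum (fun i => c i * K (τ i - y)) (Φ y)) (g : ℝ →ᵇ E) :
    HasSum (fun i => c i • ∫ y, K (τ i - y) • g y) (∫ y, Φ y • g y) := by
  have hint (i : ι) : Integrable fun y => K (τ i - y) • g y :=
    integrable_smul_boundedContinuousFunction (hK.comp_sub_left (τ i)) g
  have hbound (i : ι) : ∫ y, ‖K (τ i - y) • g y‖ ≤ (∫ y, ‖K y‖) * ‖g‖ := by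
    rw [← integral_sub_left_eq_self (fun y => ‖K y‖) volume (τ i), ← integral_mul_const]
    refine integral_mono (hint i).norm ((hK.comp_sub_left _).norm.mul_const _) fun y => ?_
    simp only [norm_smul]
    gcongr
    exact g.norm_coe_le_norm y
  have hsum := hasSum_integral_of_summable_integral_norm (μ := volume)
    (F := fun i y => c i • K (τ i - y) • g y) (fun i => (hint i).smul _) (by
      simp_rw [norm_smul (c _), integral_const_mul]
      exact (hc.mul_right _).of_nonneg_of_le (fun i => by positivity) fun i => by
        gcongr
        exact hbound i)
  have hpointwise (y : ℝ) : ∑' i, c i • K (τ i - y) • g y = Φ y • g y := by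
    simpa only [mul_smul, smul_eq_mul] using ((hΦ y).smul_const (g y)).tsum_eq
  simpa only [integral_smul, hpointwise] using hsum

theorem IsBandLimited.hasDerivAt_of_lt [CompleteSpace E] {g : ℝ →ᵇ E} (hg : IsBandLimited Ω g)
    (hΩ : 0 < Ω) {W : ℝ} (hW : Ω < W) (s : ℝ) :
    HasDerivAt g ((8 * W / Real.pi) •
      ∑' k : ℤ, boasCoeff k • g (s + ((k : ℝ) - 1 / 2) / (2 * W))) s := by
  obtain ⟨K, hone, hzero⟩ :=
    exists_schwartzMap_fourier_eq_one (r := (Ω + W) / 2) (R := W) (by linarith) (by linarith)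
  have hrep : ∀ x, ∫ y, K (x - y) • g y = g x :=
    hg.integral_sub_smul (by linarith) (by linarith) hone hzero
  have hfactor : ((8 * W / Real.pi : ℝ) : ℂ) * (Real.pi / (8 * W)) = 1 := by
    have hW₀ : (W : ℂ) ≠ 0 := by exact_mod_cast (hΩ.trans hW).ne'
    push_cast
    field_simp
  have hseries := hasSum_smul_integral_sub_smul summable_norm_boasCoeff K.integrable
    (τ := fun k => s + ((k : ℝ) - 1 / 2) / (2 * W)) (fun y => by
      simpa only [smul_eq_mul, sub_add_eq_add_sub] using
        hasSum_boasCoeff_smul_schwartzMap (hΩ.trans hW) hzero (s - y)) g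
  have hderiv := hasDerivAt_integral_schwartzMap_sub_smul K g s
  simp only [hrep, mul_smul, integral_smul] at hseries hderiv
  rwa [hseries.tsum_eq, ← Complex.coe_smul, smul_smul, hfactor, one_smul]

theorem IsBandLimited.hasDerivAt [CompleteSpace E] {g : ℝ →ᵇ E} (hg : IsBandLimited Ω g)
    (hΩ : 0 < Ω) (s : ℝ) :
    HasDerivAt g ((8 * Ω / Real.pi) •
      ∑' k : ℤ, boasCoeff k • g (s + ((k : ℝ) - 1 / 2) / (2 * Ω))) s := by
  have hlim : Tendsto (fun W : ℝ => (8 * W / Real.pi) •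
      ∑' k : ℤ, boasCoeff k • g (s + ((k : ℝ) - 1 / 2) / (2 * W))) (𝓝[>] Ω)
      (𝓝 ((8 * Ω / Real.pi) • ∑' k : ℤ, boasCoeff k • g (s + ((k : ℝ) - 1 / 2) / (2 * Ω)))) := by
    refine tendsto_nhdsWithin_of_tendsto_nhds (Tendsto.smul
      ((by fun_prop : Continuous fun W : ℝ => 8 * W / Real.pi).tendsto Ω) ?_)
    refine tendsto_tsum_of_dominated_convergence (summable_norm_boasCoeff.mul_right ‖g‖)
      (fun k => ?_) (Eventually.of_forall fun W k => ?_)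
    · refine ((g.continuous.tendsto _).comp (Tendsto.const_add _ ?_)).const_smul _
      exact tendsto_const_nhds.div (tendsto_id.const_mul 2) (by positivity)
    · rw [norm_smul]
      gcongr
      exact g.norm_coe_le_norm _
  have hderiv : Tendsto (fun W : ℝ => (8 * W / Real.pi) •
      ∑' k : ℤ, boasCoeff k • g (s + ((k : ℝ) - 1 / 2) / (2 * W))) (𝓝[>] Ω) (𝓝 (deriv g s)) := by
    refine tendsto_const_nhds.congr' ?_
    filter_upwards [self_mem_nhdsWithin] with W hW
    exact (hg.hasDerivAt_of_lt hΩ hW s).deriv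
  rw [tendsto_nhds_unique hlim hderiv]
  exact (hg.hasDerivAt_of_lt hΩ (lt_add_one Ω) s).differentiableAt.hasDerivAt

end BandLimited

theorem eLpNorm_le_tsum_of_hasSum {α ι E : Type*} [MeasurableSpace α] {μ : Measure α}
    [NormedAddCommGroup E] [Countable ι] {p : ℝ≥0∞} (hp : 1 ≤ p) {u : ι → α → E} {v : α → E}
    (hu : ∀ i, AEStronglyMeasurable (u i) μ) (h : ∀ᵐ x ∂μ, HasSum (fun i => u i x) (v x)) :
    eLpNorm v p μ ≤ ∑' i, eLpNorm (u i) p μ := by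
  have hle (s : Finset ι) : eLpNorm (∑ i ∈ s, u i) p μ ≤ ∑' i, eLpNorm (u i) p μ :=
    (eLpNorm_sum_le (fun i _ => hu i) hp).trans (ENNReal.sum_le_tsum s)
  refine Lp.eLpNorm_le_of_ae_tendsto (u := atTop) (Eventually.of_forall hle)
    (fun s => Finset.aestronglyMeasurable_sum s fun i _ => hu i) ?_
  filter_upwards [h] with x hx
  simpa only [Finset.sum_apply] using! hx

theorem integral_Ioi_eq_integral_comp_exp {E : Type*} [NormedAddCommGroup E] [NormedSpace ℝ E]
    {a : ℝ} (ha : 0 < a) (F : ℝ → E) :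
    ∫ u in Ioi (0 : ℝ), F u = ∫ s, (a * Real.exp (a * s)) • F (Real.exp (a * s)) := by
  have hexp := integral_image_eq_integral_abs_deriv_smul MeasurableSet.univ
    (fun s _ => (Real.hasDerivAt_exp s).hasDerivWithinAt) Real.exp_injective.injOn F
  have hscale := Measure.integral_comp_mul_left (fun s => Real.exp s • F (Real.exp s)) a
  rw [abs_of_pos (inv_pos.2 ha), eq_inv_smul_iff₀ ha.ne', ← integral_smul] at hscale
  simpa [image_univ, Real.range_exp, mul_smul, ← hscale] using hexp

section MellinTranslate

variable {c x : ℝ} {f : ℝ → ℂ}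

/-- The Mellin translation operator `τ_h^c`, which maps `f` to `x ↦ h ^ c * f (h * x)`. The terms of
the Boas-type series are multiples of Mellin translates of `f`. -/
noncomputable def mellinTranslate (c h : ℝ) (f : ℝ → ℂ) (x : ℝ) : ℂ :=
  ((h ^ c : ℝ) : ℂ) * f (h * x)

theorem rpow_mul_mellinTranslate {h : ℝ} (hh : 0 ≤ h) (hx : 0 ≤ x) :
    ((x ^ c : ℝ) : ℂ) * mellinTranslate c h f x = (((h * x) ^ c : ℝ) : ℂ) * f (h * x) := by
  rw [mellinTranslate, Real.mul_rpow hh hx, Complex.ofReal_mul]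
  ring

theorem hasMellinDerivAt_iff_hasDerivAt_mellinTranslate {a : ℂ} :
    HasMellinDerivAt c f a x ↔ HasDerivAt (fun h => mellinTranslate c h f x) a 1 := by
  rw [hasDerivAt_iff_tendsto_slope, HasMellinDerivAt]
  refine tendsto_congr fun h => ?_
  simp [mellinQuotient, mellinTranslate, slope_def_module, div_eq_inv_mul]

theorem mellinBoasTerm_eq (c T : ℝ) (f : ℝ → ℂ) (x : ℝ) (k : ℤ) :
    mellinBoasTerm c T f x k =
      boasCoeff k * mellinTranslate c (Real.exp (((k : ℝ) - 1 / 2) / T)) f x := by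
  rw [mellinBoasTerm, boasCoeff, mellinTranslate, ← Real.exp_mul, mul_div_right_comm, mul_comm x,
    mul_assoc]

end MellinTranslate

section MellinPullback

variable {c x : ℝ} {f : ℝ → ℂ}

/-- The weighted function `x ^ c * f x` in the logarithmic variable `s` with `x = exp (2 π s)`. The
factor `2 π` matches Mathlib's normalization of the Fourier transform. -/
noncomputable def mellinPullback (c : ℝ) (f : ℝ → ℂ) (s : ℝ) : ℂ :=
  ((Real.exp (2 * Real.pi * s) ^ c : ℝ) : ℂ) * f (Real.exp (2 * Real.pi * s))

theorem continuousOn_rpow_mul (c : ℝ) (hf : ContinuousOn f (Ioi 0)) :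
    ContinuousOn (fun x : ℝ => ((x ^ c : ℝ) : ℂ) * f x) (Ioi 0) :=
  (Complex.continuous_ofReal.comp_continuousOn
    (continuousOn_id.rpow_const fun _ hx => Or.inl (ne_of_gt hx))).mul hf

theorem continuous_mellinPullback (hf : ContinuousOn f (Ioi 0)) :
    Continuous (mellinPullback c f) :=
  (continuousOn_rpow_mul c hf).comp_continuous (f := fun s => Real.exp (2 * Real.pi * s))
    (by fun_prop) fun _ => Real.exp_pos _

theorem norm_mellinPullback_le (hf : mellinNorm c ∞ f < ∞) (s : ℝ) :
    ‖mellinPullback c f s‖ ≤ (mellinNorm c ∞ f).toReal := by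
  rw [← toReal_enorm]
  refine ENNReal.toReal_mono hf.ne ?_
  rw [mellinNorm, if_pos rfl]
  exact le_iSup₂ (f := fun (x : ℝ) (_ : x ∈ Ioi (0 : ℝ)) => ‖((x ^ c : ℝ) : ℂ) * f x‖ₑ)
    (Real.exp (2 * Real.pi * s)) (Real.exp_pos _)

theorem mellinPullback_log_add (c : ℝ) (f : ℝ → ℂ) (hx : 0 < x) (s : ℝ) :
    mellinPullback c f (Real.log x / (2 * Real.pi) + s) =
      ((x ^ c : ℝ) : ℂ) * mellinTranslate c (Real.exp (2 * Real.pi * s)) f x := by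
  rw [rpow_mul_mellinTranslate (Real.exp_pos _).le hx.le, mellinPullback, mul_add,
    mul_div_cancel₀ _ Real.two_pi_pos.ne', Real.exp_add, Real.exp_log hx, mul_comm x]

theorem hasMellinDerivAt_of_hasDerivAt_mellinPullback {a : ℂ} (hx : 0 < x)
    (h : HasDerivAt (mellinPullback c f) (((x ^ c : ℝ) : ℂ) * a) (Real.log x / (2 * Real.pi))) :
    HasMellinDerivAt c f ((2 * Real.pi)⁻¹ * a) x := by
  have hxc : ((x ^ c : ℝ) : ℂ) ≠ 0 := by exact_mod_cast (Real.rpow_pos_of_pos hx c).ne'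
  have hlog : HasDerivAt (fun h : ℝ => Real.log x / (2 * Real.pi) + Real.log h / (2 * Real.pi))
      (2 * Real.pi)⁻¹ 1 := by
    simpa using ((Real.hasDerivAt_log one_ne_zero).div_const (2 * Real.pi)).const_add
      (Real.log x / (2 * Real.pi))
  have hcomp := (HasDerivAt.scomp (1 : ℝ) (by simpa using! h) hlog).const_mul ((x ^ c : ℝ) : ℂ)⁻¹
  rw [hasMellinDerivAt_iff_hasDerivAt_mellinTranslate]
  convert! hcomp.congr_of_eventuallyEq ?_ using 1
  · rw [Complex.real_smul, mul_left_comm, inv_mul_cancel_left₀ hxc]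
  · filter_upwards [lt_mem_nhds one_pos] with h hh
    rw [Function.comp_apply, mellinPullback_log_add c f hx, inv_mul_cancel_left₀ hxc,
      mul_div_cancel₀ _ Real.two_pi_pos.ne', Real.exp_log hh]

theorem ofReal_exp_cpow_mul_I (s t : ℝ) :
    ((Real.exp (2 * Real.pi * s) : ℝ) : ℂ) ^ ((t : ℂ) * Complex.I) = 𝐞 (t * s) := by
  rw [Complex.cpow_def_of_ne_zero (by exact_mod_cast (Real.exp_pos _).ne'),
    ← Complex.ofReal_log (Real.exp_pos _).le, Real.log_exp, Real.fourierChar_apply]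
  push_cast
  ring_nf

theorem IsMellinBandLimited.isBandLimited {σ : ℝ} (hf : IsMellinBandLimited c σ f) :
    IsBandLimited σ (mellinPullback c f) := by
  intro K r R hr hK
  let φ : 𝓢(ℝ, ℂ) := 𝓕 K
  have hsupp : tsupport φ ⊆ {t | |t| ∈ Icc r R} :=
    closure_minimal (fun t ht => by_contra fun h => ht (hK t h))
      (isClosed_Icc.preimage continuous_abs)
  have hcompact : HasCompactSupport φ :=
    HasCompactSupport.intro (isCompact_closedBall (0 : ℝ) R) fun t ht =>
      hK t fun h => ht (by simpa using h.2)
  have h := hf φ (φ.smooth _) hcompact fun t ht => hr.trans_le (hsupp ht).1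
  have hinner (s : ℝ) :
      ∫ t : ℝ, φ t * ((Real.exp (2 * Real.pi * s) : ℝ) : ℂ) ^ ((t : ℂ) * Complex.I) = K s := by
    rw [schwartzMap_eq_integral_fourier]
    simp only [ofReal_exp_cpow_mul_I, Circle.smul_def, smul_eq_mul, mul_comm (𝐞 _ : ℂ), φ]
  have hweight (s : ℝ) : Real.exp (2 * Real.pi * s) ^ c =
      Real.exp (2 * Real.pi * s) ^ (c - 1) * Real.exp (2 * Real.pi * s) := by
    rw [← Real.rpow_add_one (Real.exp_pos _).ne', sub_add_cancel]
  have hintegrand (s : ℝ) : (2 * Real.pi * Real.exp (2 * Real.pi * s)) •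
      (f (Real.exp (2 * Real.pi * s)) * ((Real.exp (2 * Real.pi * s) ^ (c - 1) : ℝ) : ℂ) * K s) =
      (2 * Real.pi) • (K s • mellinPullback c f s) := by
    simp only [mellinPullback, hweight, Complex.real_smul, smul_eq_mul, Complex.ofReal_mul]
    ring
  rw [integral_Ioi_eq_integral_comp_exp Real.two_pi_pos] at h
  simp only [hinner, hintegrand, integral_smul] at h
  exact (smul_eq_zero.1 h).resolve_left Real.two_pi_pos.ne'

end MellinPullback

section MellinNorm

variable {c : ℝ} {p : ℝ≥0∞} {f : ℝ → ℂ}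

theorem measurePreserving_exp_mellinMeasure :
    MeasurePreserving Real.exp volume mellinMeasure := by
  refine ⟨Real.measurable_exp, Measure.ext fun s hs => ?_⟩
  have himage : Real.exp '' (Real.exp ⁻¹' s) = s ∩ Ioi 0 := by
    rw [image_preimage_eq_inter_range, Real.range_exp]
  have hjacobian (x : ℝ) : ENNReal.ofReal |Real.exp x| * ENNReal.ofReal (Real.exp x)⁻¹ = 1 := by
    rw [Real.abs_exp, ← ENNReal.ofReal_mul (Real.exp_pos x).le,
      mul_inv_cancel₀ (Real.exp_pos x).ne', ENNReal.ofReal_one]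
  rw [Measure.map_apply Real.measurable_exp hs, mellinMeasure, withDensity_apply _ hs,
    Measure.restrict_restrict hs, ← himage, lintegral_image_eq_lintegral_abs_deriv_mul
      (Real.measurable_exp hs) (fun x _ => (Real.hasDerivAt_exp x).hasDerivWithinAt)
      Real.exp_injective.injOn]
  simp only [hjacobian, setLIntegral_one]

theorem measurePreserving_mul_left_mellinMeasure {h : ℝ} (hh : 0 < h) :
    MeasurePreserving (h * ·) mellinMeasure mellinMeasure := by
  refine ⟨by fun_prop, ?_⟩
  have hconj : (h * ·) ∘ Real.exp = Real.exp ∘ (Real.log h + ·) := by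
    ext s
    simp [Real.exp_add, Real.exp_log hh]
  rw [← measurePreserving_exp_mellinMeasure.map_eq,
    Measure.map_map (by fun_prop) Real.measurable_exp, hconj,
    ← Measure.map_map Real.measurable_exp (by fun_prop), map_add_left_eq_self]

theorem mellinMeasure_absolutelyContinuous : mellinMeasure ≪ volume.restrict (Ioi 0) :=
  withDensity_absolutelyContinuous _ _

theorem ae_mellinMeasure_pos : ∀ᵐ x ∂mellinMeasure, 0 < x :=
  mellinMeasure_absolutelyContinuous.ae_le (ae_restrict_mem measurableSet_Ioi)

theorem aestronglyMeasurable_mellinMeasure_of_continuousOn (hf : ContinuousOn f (Ioi 0)) :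
    AEStronglyMeasurable f mellinMeasure :=
  (hf.aestronglyMeasurable measurableSet_Ioi).mono_ac mellinMeasure_absolutelyContinuous

theorem mellinNorm_const_mul (a : ℂ) :
    mellinNorm c p (fun x => a * f x) = ‖a‖ₑ * mellinNorm c p f := by
  simp only [mellinNorm, mul_left_comm _ a]
  split_ifs
  · simp only [enorm_mul, ENNReal.mul_iSup]
  · exact eLpNorm_const_smul a (fun x : ℝ => ((x ^ c : ℝ) : ℂ) * f x) p mellinMeasure

theorem mellinNorm_mellinTranslate {h : ℝ} (hh : 0 < h) :
    mellinNorm c p (mellinTranslate c h f) = mellinNorm c p f := by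
  have hweight (x : ℝ) (hx : x ∈ Ioi (0 : ℝ)) :=
    rpow_mul_mellinTranslate (c := c) (f := f) hh.le (mem_Ioi.1 hx).le
  unfold mellinNorm
  split_ifs
  · rw [iSup_congr fun x => iSup_congr fun hx => congrArg enorm (hweight x hx),
      ← iSup_image (f := (h * ·)) (g := fun x : ℝ => ‖((x ^ c : ℝ) : ℂ) * f x‖ₑ),
      image_mul_left_Ioi hh, mul_zero]
  · rw [eLpNorm_congr_ae (ae_mellinMeasure_pos.mono hweight)]
    conv_rhs => rw [← (measurePreserving_mul_left_mellinMeasure hh).map_eq]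
    exact ((measurableEmbedding_mulLeft₀ hh.ne').eLpNorm_map_measure
      (g := fun x : ℝ => ((x ^ c : ℝ) : ℂ) * f x)).symm

theorem mellinNorm_le_tsum_of_hasSum {ι : Type*} [Countable ι] (hp : 1 ≤ p) {u : ι → ℝ → ℂ}
    {v : ℝ → ℂ} (hu : ∀ i, ContinuousOn (u i) (Ioi 0))
    (h : ∀ x, 0 < x → HasSum (fun i => u i x) (v x)) :
    mellinNorm c p v ≤ ∑' i, mellinNorm c p (u i) := by
  have hweight (x : ℝ) (hx : 0 < x) := (h x hx).mul_left ((x ^ c : ℝ) : ℂ)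
  unfold mellinNorm
  split_ifs
  · refine iSup₂_le fun x hx => ?_
    rw [← (hweight x hx).tsum_eq]
    refine enorm_tsum_le_tsum_enorm.trans (ENNReal.tsum_le_tsum fun i => ?_)
    exact le_iSup₂ (f := fun (x : ℝ) (_ : x ∈ Ioi (0 : ℝ)) => ‖((x ^ c : ℝ) : ℂ) * u i x‖ₑ) x hx
  · exact eLpNorm_le_tsum_of_hasSum hp
      (fun i => aestronglyMeasurable_mellinMeasure_of_continuousOn (continuousOn_rpow_mul c (hu i)))
      (ae_mellinMeasure_pos.mono hweight)

end MellinNorm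

section MellinBoas

variable {c T x : ℝ} {f : ℝ → ℂ}

theorem boasCoeff_smul_mellinPullback_log_add (hx : 0 < x) (k : ℤ) :
    boasCoeff k • mellinPullback c f
      (Real.log x / (2 * Real.pi) + ((k : ℝ) - 1 / 2) / (2 * (Real.pi * T))) =
      ((x ^ c : ℝ) : ℂ) * mellinBoasTerm c T f x k := by
  have harg : 2 * Real.pi * (((k : ℝ) - 1 / 2) / (2 * (Real.pi * T))) = ((k : ℝ) - 1 / 2) / T := by
    rw [← mul_assoc, mul_div_assoc', mul_div_mul_left _ _ Real.two_pi_pos.ne']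
  rw [mellinPullback_log_add c f hx, harg, mellinBoasTerm_eq, smul_eq_mul, mul_left_comm]

theorem summable_mellinBoasTerm (hf : mellinNorm c ∞ f < ∞) (hx : 0 < x) :
    Summable (mellinBoasTerm c T f x) := by
  have hxc : ((x ^ c : ℝ) : ℂ) ≠ 0 := by exact_mod_cast (Real.rpow_pos_of_pos hx c).ne'
  rw [← summable_mul_left_iff hxc]
  simp_rw [← boasCoeff_smul_mellinPullback_log_add hx]
  refine (summable_norm_boasCoeff.mul_right (mellinNorm c ∞ f).toReal).of_norm_bounded fun k => ?_
  rw [norm_smul]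
  gcongr
  exact norm_mellinPullback_le hf _

theorem hasMellinDerivAt_tsum_mellinBoasTerm (hT : 0 < T)
    (hf : f ∈ MellinBernstein c ∞ (Real.pi * T)) (hx : 0 < x) :
    HasMellinDerivAt c f (((4 * T / Real.pi : ℝ) : ℂ) * ∑' k : ℤ, mellinBoasTerm c T f x k) x := by
  obtain ⟨hcont, hbound, hband⟩ := hf
  let g : ℝ →ᵇ ℂ := .ofNormedAddCommGroup (mellinPullback c f) (continuous_mellinPullback hcont) _
    (norm_mellinPullback_le hbound)
  have hg : HasDerivAt (mellinPullback c f)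
      ((8 * (Real.pi * T) / Real.pi) • ∑' k : ℤ, boasCoeff k • mellinPullback c f
        (Real.log x / (2 * Real.pi) + ((k : ℝ) - 1 / 2) / (2 * (Real.pi * T))))
      (Real.log x / (2 * Real.pi)) :=
    IsBandLimited.hasDerivAt (g := g) hband.isBandLimited (by positivity) _
  simp_rw [boasCoeff_smul_mellinPullback_log_add hx, tsum_mul_left, ← mul_smul_comm] at hg
  convert! hasMellinDerivAt_of_hasDerivAt_mellinPullback hx hg using 1
  have hpi : (Real.pi : ℂ) ≠ 0 := by exact_mod_cast Real.pi_ne_zero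
  rw [Complex.real_smul]
  push_cast
  field_simp
  ring

theorem mellinDeriv_eq_tsum_mellinBoasTerm (hT : 0 < T)
    (hf : f ∈ MellinBernstein c ∞ (Real.pi * T)) (hx : 0 < x) :
    mellinDeriv c f x = ((4 * T / Real.pi : ℝ) : ℂ) * ∑' k : ℤ, mellinBoasTerm c T f x k :=
  (hasMellinDerivAt_tsum_mellinBoasTerm hT hf hx).limUnder_eq

theorem tsum_enorm_mul_boasCoeff (hT : 0 ≤ T) :
    ∑' k : ℤ, ‖((4 * T / Real.pi : ℝ) : ℂ) * boasCoeff k‖ₑ = ENNReal.ofReal (Real.pi * T) := by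
  have hconst : 4 * T / Real.pi * (Real.pi ^ 2 / 4) = Real.pi * T := by field_simp
  have h := hasSum_norm_boasCoeff.mul_left (4 * T / Real.pi)
  rw [← hconst, ← h.tsum_eq, ENNReal.ofReal_tsum_of_nonneg (fun k => by positivity) h.summable]
  refine tsum_congr fun k => ?_
  rw [← ofReal_norm, norm_mul, Complex.norm_real, Real.norm_of_nonneg (by positivity)]

theorem mellinNorm_mellinDeriv_le (hT : 0 < T) (hf : f ∈ MellinBernstein c ∞ (Real.pi * T))
    {p : ℝ≥0∞} (hp : 1 ≤ p) :
    mellinNorm c p (mellinDeriv c f) ≤ ENNReal.ofReal (Real.pi * T) * mellinNorm c p f := by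
  let h (k : ℤ) : ℝ := Real.exp (((k : ℝ) - 1 / 2) / T)
  let b (k : ℤ) : ℂ := ((4 * T / Real.pi : ℝ) : ℂ) * boasCoeff k
  have hcont (k : ℤ) : ContinuousOn (fun x => b k * mellinTranslate c (h k) f x) (Ioi 0) :=
    continuousOn_const.mul <| continuousOn_const.mul <| hf.1.comp (by fun_prop)
      fun x hx => mul_pos (Real.exp_pos _) hx
  have hsum (x : ℝ) (hx : 0 < x) :
      HasSum (fun k => b k * mellinTranslate c (h k) f x) (mellinDeriv c f x) := by
    rw [mellinDeriv_eq_tsum_mellinBoasTerm hT hf hx]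
    simpa only [mellinBoasTerm_eq, mul_assoc, b, h] using
      (summable_mellinBoasTerm hf.2.1 hx).hasSum.mul_left ((4 * T / Real.pi : ℝ) : ℂ)
  calc mellinNorm c p (mellinDeriv c f)
      ≤ ∑' k, mellinNorm c p (fun x => b k * mellinTranslate c (h k) f x) :=
        mellinNorm_le_tsum_of_hasSum hp hcont hsum
    _ = ∑' k, ‖b k‖ₑ * mellinNorm c p f := by
        simp only [mellinNorm_const_mul, mellinNorm_mellinTranslate (Real.exp_pos _), h]
    _ = ENNReal.ofReal (Real.pi * T) * mellinNorm c p f := by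
        rw [ENNReal.tsum_mul_right, tsum_enorm_mul_boasCoeff hT.le]

end MellinBoas

theorem theorem9 (c T : ℝ) (hT : 0 < T) (f : ℝ → ℂ)
    (hf : f ∈ MellinBernstein c ∞ (Real.pi * T)) :
    (∀ x : ℝ, 0 < x →
      HasMellinDerivAt c f (mellinDeriv c f x) x ∧
      Summable (mellinBoasTerm c T f x) ∧
      mellinDeriv c f x = ((4 * T / Real.pi : ℝ) : ℂ) * ∑' k : ℤ, mellinBoasTerm c T f x k) ∧
    (∀ p : ℝ≥0∞, 1 ≤ p →
      mellinNorm c p (mellinDeriv c f) ≤ ENNReal.ofReal (Real.pi * T) * mellinNorm c p f) := by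
  refine ⟨fun x hx => ⟨?_, summable_mellinBoasTerm hf.2.1 hx,
    mellinDeriv_eq_tsum_mellinBoasTerm hT hf hx⟩, fun p hp => mellinNorm_mellinDeriv_le hT hf hp⟩
  rw [mellinDeriv_eq_tsum_mellinBoasTerm hT hf hx]
  exact hasMellinDerivAt_tsum_mellinBoasTerm hT hf hx
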